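/- Let $d \ge 0$ and $k \ge 2$ be integers and let $X \subset [0,1]^d$ be compact and non-empty. For $a \ge 0$ and $\mathbf b = (b_1,\dots,b_d) \in \mathbb Z^d$ with $0 \le b_i < k^a$, put $$\mathcal K_{a,\mathbf b}^k(X) = \Big\{(k^a x_1 - b_1, \dots, k^a x_d - b_d) : (x_1,\dots,x_d) \in X \cap \prod_{i=1}^d \Big[\tfrac{b_i}{k^a}, \tfrac{b_i+1}{k^a}\Big]\Big\}.$$ Suppose that $X$ is $k$-self-similar, that is, only finitely many different sets occur among the $\mathcal K_{a,\mathbf b}^k(X)$, and let $X_0, \dots, X_{n-1}$ be a list, without repetition, of all the non-empty ones. Let $A = (A_{ij})_{i,j=0}^{n-1}$ be the matrix whose entry $A_{ij}$ is the number of $\frac1k$-scaled copies of $X_i$ inside $X_j$, that is, the number of $\mathbf b \in \{0,\dots,k-1\}^d$ with $\mathcal K_{1,\mathbf b}^k(X_j) = X_i$. Then the spectral radius $\rho(A)$ (the largest modulus of a complex eigenvalue of $A$) satisfies $1 \le \rho(A) < \infty$, and $$\dim_{\mathcal H}(X) = \log_k \rho(A),$$ where $\dim_{\mathcal H}$ is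 the Hausdorff dimension. -/

import Mathlib

open scoped ENNReal

noncomputable section

/-- The unit cube `[0,1]^d` in Euclidean space. -/
def unitCube (d : ℕ) : Set (EuclideanSpace ℝ (Fin d)) :=
  {x | ∀ i, x i ∈ Set.Icc (0 : ℝ) 1}

/-- The closed grid hyper-cube `∏ᵢ [bᵢ / k^a, (bᵢ + 1) / k^a]`. -/
def gridCube {d : ℕ} (k a : ℕ) (b : Fin d → ℕ) : Set (EuclideanSpace ℝ (Fin d)) :=
  {x | ∀ i, x i ∈ Set.Icc ((b i : ℝ) / (k : ℝ) ^ a) (((b i : ℝ) + 1) / (k : ℝ) ^ a)}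

/-- The map `x ↦ (k^a x₁ - b₁, …, k^a x_d - b_d)`, which sends the grid hyper-cube
`gridCube k a b` onto the unit cube. -/
def rescale {d : ℕ} (k a : ℕ) (b : Fin d → ℕ) (x : EuclideanSpace ℝ (Fin d)) :
    EuclideanSpace ℝ (Fin d) :=
  WithLp.toLp 2 fun i => (k : ℝ) ^ a * x i - (b i : ℝ)

/-- The set `K_{a,b}^k`: the part of `X` inside a grid hyper-cube, scaled back up to the
unit cube. -/
def kernelSet {d : ℕ} (k a : ℕ) (b : Fin d → ℕ) (X : Set (EuclideanSpace ℝ (Fin d))) :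
    Set (EuclideanSpace ℝ (Fin d)) :=
  rescale k a b '' (X ∩ gridCube k a b)

/-- The collection of all sets `K_{a,b}^k` with `a ≥ 0` and `0 ≤ bᵢ < k^a`. -/
def kKernel {d : ℕ} (k : ℕ) (X : Set (EuclideanSpace ℝ (Fin d))) :
    Set (Set (EuclideanSpace ℝ (Fin d))) :=
  {Z | ∃ (a : ℕ) (b : Fin d → ℕ), (∀ i, b i < k ^ a) ∧ Z = kernelSet k a b X}

/-- `X ⊆ [0,1]^d` is `k`-self-similar: it is compact and has a finite `k`-kernel. -/
structure IsSelfSimilarSet {d : ℕ} (k : ℕ) (X : Set (EuclideanSpace ℝ (Fin d))) : Prop where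
  isCompact : IsCompact X
  subset_unitCube : X ⊆ unitCube d
  finite_kKernel : (kKernel k X).Finite

/-- The matrix `A` of a list of sets `X₀, …, X_{n-1}`: the entry `A i j` is the number of
`1/k`-scaled copies of `X i` inside `X j`, that is, the number of grid hyper-cubes of side `1/k`
whose intersection with `X j`, scaled up to the unit cube, is `X i`. -/
def copyMatrix {d n : ℕ} (k : ℕ) (Y : Fin n → Set (EuclideanSpace ℝ (Fin d))) :
    Matrix (Fin n) (Fin n) ℕ :=
  Matrix.of fun i j =>
    Nat.card {b : Fin d → Fin k // kernelSet k 1 (fun l => (b l : ℕ)) (Y j) = Y i}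

/-- The spectral radius of a matrix of natural numbers: the largest modulus of a complex
eigenvalue. -/
def natSpectralRadius {n : ℕ} (A : Matrix (Fin n) (Fin n) ℕ) : ℝ≥0∞ :=
  spectralRadius ℂ (A.map (Nat.cast : ℕ → ℂ))

end

/-! Let `N_m(Z)` be the number of closed level-`m` grid cubes meeting `Z`. The cubes inside a given
cube are the cubes of the corresponding kernel set, so the `j`-th column sum of `A ^ m` is
`N_m(X_j)` (`sum_copyMatrix_pow`). By Gelfand's formula, `ρ(A)` is then governed by the exponential
growth of these counts.

Upper bound: for `k ^ t > ρ(A)`, eventually `N_m(X) ≤ n * k ^ (t m)`, and covering `X` by these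
cubes gives `dimH X ≤ t` (`dimH_le_of_card_cubes_le`).

Lower bound: if `dimH X < t`, every kernel set is compact and `μH[t]`-null, so finitely many balls
of radii `2 / k ^ a` with `∑ k ^ (-a t) ≤ 5 ^ (-d)` cover it. Each ball reaches at most `5 ^ d`
cubes of its own level, and below each of them lies another kernel set. This recursion gives `N_m(Z)
≤ C * k ^ (t m)` for all kernel sets at once (`exists_card_cubes_le`), hence `ρ(A) ≤ k ^ t`. No
irreducibility of `A` is needed. -/

/-! ### Grid cubes and kernel sets. -/

theorem mem_gridCube_iff {d : ℕ} {k : ℕ} (hk : 0 < k) (a : ℕ) (b : Fin d → ℕ)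
    (x : EuclideanSpace ℝ (Fin d)) : x ∈ gridCube k a b ↔ rescale k a b x ∈ unitCube d := by
  have h : (0 : ℝ) < (k : ℝ) ^ a := by positivity
  refine forall_congr' fun i => ?_
  simp only [rescale, Set.mem_Icc, div_le_iff₀ h, le_div_iff₀ h]
  constructor <;> rintro ⟨h1, h2⟩ <;> constructor <;> linarith

/-- With the cube written as a preimage, composing kernel operations reduces to composing the maps
`rescale`. -/
theorem kernelSet_eq {d : ℕ} {k : ℕ} (hk : 0 < k) (a : ℕ) (b : Fin d → ℕ)
    (Z : Set (EuclideanSpace ℝ (Fin d))) :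
    kernelSet k a b Z = rescale k a b '' (Z ∩ rescale k a b ⁻¹' unitCube d) := by
  unfold kernelSet
  congr 1
  ext x
  simp [mem_gridCube_iff hk]

theorem kernelSet_subset_unitCube {d : ℕ} {k : ℕ} (hk : 0 < k) (a : ℕ) (b : Fin d → ℕ)
    (Z : Set (EuclideanSpace ℝ (Fin d))) : kernelSet k a b Z ⊆ unitCube d := by
  rw [kernelSet_eq hk]
  rintro _ ⟨x, hx, rfl⟩
  exact hx.2

theorem rescale_rescale {d : ℕ} (k a m : ℕ) (b c : Fin d → ℕ) (x : EuclideanSpace ℝ (Fin d)) :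
    rescale k m c (rescale k a b x) = rescale k (a + m) (fun i => k ^ m * b i + c i) x := by
  ext i
  simp only [rescale]
  push_cast
  ring

/-- A grid cube of a rescaled grid cube is a grid cube. -/
theorem kernelSet_kernelSet {d : ℕ} {k : ℕ} (hk : 0 < k) (a m : ℕ) (b c : Fin d → ℕ)
    (hc : ∀ i, c i < k ^ m) (Z : Set (EuclideanSpace ℝ (Fin d))) :
    kernelSet k m c (kernelSet k a b Z) = kernelSet k (a + m) (fun i => k ^ m * b i + c i) Z := by
  -- The inner cube lies in the outer one because `c i + 1 ≤ k ^ m`, so the outer condition is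
  -- redundant.
  have key : ∀ u : EuclideanSpace ℝ (Fin d), rescale k m c u ∈ unitCube d → u ∈ unitCube d := by
    intro u hu i
    have hpos : (0 : ℝ) < (k : ℝ) ^ m := by positivity
    obtain ⟨h1, h2⟩ := hu i
    simp only [rescale] at h1 h2
    have h3 : (c i : ℝ) + 1 ≤ (k : ℝ) ^ m := by exact_mod_cast hc i
    have h4 : (0 : ℝ) ≤ c i := by positivity
    constructor
    · by_contra! h
      nlinarith
    · by_contra! h
      nlinarith
  rw [kernelSet_eq hk, kernelSet_eq hk, kernelSet_eq hk]
  ext y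
  constructor
  · rintro ⟨_, ⟨⟨x, ⟨hx, -⟩, rfl⟩, hu⟩, rfl⟩
    rw [Set.mem_preimage, rescale_rescale] at hu
    exact ⟨x, ⟨hx, hu⟩, (rescale_rescale ..).symm⟩
  · rintro ⟨x, ⟨hx, hu⟩, rfl⟩
    rw [Set.mem_preimage, ← rescale_rescale] at hu
    exact ⟨_, ⟨⟨x, ⟨hx, key _ hu⟩, rfl⟩, hu⟩, rescale_rescale ..⟩

theorem kernelSet_mem_kKernel {d : ℕ} {k : ℕ} (hk : 0 < k) {X Z : Set (EuclideanSpace ℝ (Fin d))}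
    (hZ : Z ∈ kKernel k X) (m : ℕ) (c : Fin d → ℕ) (hc : ∀ i, c i < k ^ m) :
    kernelSet k m c Z ∈ kKernel k X := by
  obtain ⟨a, b, hb, rfl⟩ := hZ
  refine ⟨a + m, _, fun i => ?_, kernelSet_kernelSet hk a m b c hc X⟩
  calc k ^ m * b i + c i < k ^ m * b i + k ^ m := by gcongr; exact hc i
    _ = k ^ m * (b i + 1) := by ring
    _ ≤ k ^ m * k ^ a := by gcongr; exact hb i
    _ = k ^ (a + m) := by ring

theorem self_mem_kKernel {d : ℕ} {k : ℕ} (hk : 0 < k) {X : Set (EuclideanSpace ℝ (Fin d))}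
    (hX : X ⊆ unitCube d) : X ∈ kKernel k X := by
  have h : rescale k 0 (fun _ : Fin d => 0) = id := by
    ext x i
    simp [rescale]
  refine ⟨0, fun _ => 0, by simp, ?_⟩
  rw [kernelSet_eq hk, h]
  simpa using hX

theorem continuous_rescale {d : ℕ} (k a : ℕ) (b : Fin d → ℕ) : Continuous (rescale k a b) := by
  unfold rescale
  fun_prop

theorem isClosed_unitCube (d : ℕ) : IsClosed (unitCube d) := by
  have : unitCube d = ⋂ i, (fun x : EuclideanSpace ℝ (Fin d) => x i) ⁻¹' Set.Icc 0 1 := by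
    ext x
    simp [unitCube]
  rw [this]
  exact isClosed_iInter fun i => isClosed_Icc.preimage (by fun_prop)

theorem isCompact_kernelSet {d : ℕ} {k : ℕ} (hk : 0 < k) (a : ℕ) (b : Fin d → ℕ)
    {Z : Set (EuclideanSpace ℝ (Fin d))} (hZ : IsCompact Z) : IsCompact (kernelSet k a b Z) := by
  rw [kernelSet_eq hk]
  have hc := continuous_rescale k a b
  exact (hZ.inter_right ((isClosed_unitCube d).preimage hc)).image hc

theorem lipschitzWith_rescale {d : ℕ} (k a : ℕ) (b : Fin d → ℕ) :
    LipschitzWith ((k : NNReal) ^ a) (rescale k a b) := by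
  refine LipschitzWith.of_dist_le_mul fun x y => le_of_eq ?_
  have : rescale k a b x - rescale k a b y = (k : ℝ) ^ a • (x - y) := by
    ext i
    simp [rescale]
    ring
  rw [dist_eq_norm, this, norm_smul, dist_eq_norm]
  simp

theorem dimH_kernelSet_le {d : ℕ} (k a : ℕ) (b : Fin d → ℕ)
    (Z : Set (EuclideanSpace ℝ (Fin d))) : dimH (kernelSet k a b Z) ≤ dimH Z :=
  ((lipschitzWith_rescale k a b).dimH_image_le _).trans (dimH_mono Set.inter_subset_left)

theorem exists_mem_gridCube {d : ℕ} {k : ℕ} (hk : 0 < k) (m : ℕ)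
    {x : EuclideanSpace ℝ (Fin d)} (hx : x ∈ unitCube d) :
    ∃ c : Fin d → ℕ, (∀ i, c i < k ^ m) ∧ x ∈ gridCube k m c := by
  have hkm : 0 < k ^ m := by positivity
  have hkr : (0 : ℝ) < (k : ℝ) ^ m := by positivity
  -- The minimum matters only when `x i = 1`, where the floor is the inadmissible index `k ^ m`.
  refine ⟨fun i => min ⌊(k : ℝ) ^ m * x i⌋₊ (k ^ m - 1), fun i => by grind, ?_⟩
  rw [mem_gridCube_iff hk]
  intro i
  obtain ⟨h0, h1⟩ := hx i
  have hfl := Nat.floor_le (mul_nonneg hkr.le h0)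
  have hlt := Nat.lt_floor_add_one ((k : ℝ) ^ m * x i)
  have hsub : ((k ^ m - 1 : ℕ) : ℝ) = (k : ℝ) ^ m - 1 := by
    rw [Nat.cast_sub hkm]
    push_cast
    ring
  have hle : (k : ℝ) ^ m * x i ≤ (k : ℝ) ^ m := mul_le_of_le_one_right hkr.le h1
  simp only [rescale, Set.mem_Icc]
  rcases min_cases ⌊(k : ℝ) ^ m * x i⌋₊ (k ^ m - 1) with ⟨h, _⟩ | ⟨h, h'⟩
  · rw [h]
    constructor <;> linarith
  · rw [h, hsub]
    have : ((k ^ m - 1 : ℕ) : ℝ) + 1 ≤ ⌊(k : ℝ) ^ m * x i⌋₊ := by exact_mod_cast h'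
    rw [hsub] at this
    constructor <;> linarith

/-! ### Counting cubes, and powers of the copy matrix. -/

open Classical in
/-- The indices of the grid cubes of level `m` that meet `Z`. -/
noncomputable def cubes {d : ℕ} (k m : ℕ) (Z : Set (EuclideanSpace ℝ (Fin d))) :
    Finset (Fin d → ℕ) :=
  (Fintype.piFinset fun _ => Finset.range (k ^ m)).filter fun c => (kernelSet k m c Z).Nonempty

theorem mem_cubes {d : ℕ} {k m : ℕ} {Z : Set (EuclideanSpace ℝ (Fin d))} {c : Fin d → ℕ} :
    c ∈ cubes k m Z ↔ (∀ i, c i < k ^ m) ∧ (kernelSet k m c Z).Nonempty := by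
  simp [cubes]

theorem cubes_empty {d : ℕ} (k m : ℕ) : cubes k m (∅ : Set (EuclideanSpace ℝ (Fin d))) = ∅ := by
  ext c
  simp [mem_cubes, kernelSet]

theorem card_cubes_le {d : ℕ} (k m : ℕ) (Z : Set (EuclideanSpace ℝ (Fin d))) :
    (cubes k m Z).card ≤ (k ^ m) ^ d := by
  classical
  refine (Finset.card_filter_le _ _).trans ?_
  simp

theorem subset_iUnion_cubes {d : ℕ} {k : ℕ} (hk : 0 < k) (m : ℕ)
    {Z : Set (EuclideanSpace ℝ (Fin d))} (hZ : Z ⊆ unitCube d) :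
    Z ⊆ ⋃ c : cubes k m Z, gridCube k m c.1 := by
  intro x hx
  obtain ⟨c, hc, hxc⟩ := exists_mem_gridCube hk m (hZ hx)
  exact Set.mem_iUnion.2 ⟨⟨c, mem_cubes.2 ⟨hc, ⟨_, x, ⟨hx, hxc⟩, rfl⟩⟩⟩, hxc⟩

theorem one_le_card_cubes {d : ℕ} {k : ℕ} (hk : 0 < k) (m : ℕ)
    {Z : Set (EuclideanSpace ℝ (Fin d))} (hZ : Z ⊆ unitCube d) (hne : Z.Nonempty) :
    1 ≤ (cubes k m Z).card := by
  obtain ⟨x, hx⟩ := hne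
  obtain ⟨c, -⟩ := Set.mem_iUnion.1 (subset_iUnion_cubes hk m hZ hx)
  exact Finset.card_pos.2 ⟨c.1, c.2⟩

/-- The cubes of level `a + m` inside a cube of level `a` are the cubes of level `m` of the
rescaled set. -/
theorem card_filter_cubes_add {d : ℕ} {k : ℕ} (hk : 0 < k) (a m : ℕ) (b : Fin d → ℕ)
    (hb : ∀ i, b i < k ^ a) (Z : Set (EuclideanSpace ℝ (Fin d))) :
    ((cubes k (a + m) Z).filter fun c => (fun i => c i / k ^ m) = b).card =
      (cubes k m (kernelSet k a b Z)).card := by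
  have hpos : 0 < k ^ m := by positivity
  symm
  refine Finset.card_bij (fun c _ i => k ^ m * b i + c i) ?_ ?_ ?_
  · intro c hc
    obtain ⟨hc, hne⟩ := mem_cubes.1 hc
    rw [kernelSet_kernelSet hk a m b c hc] at hne
    refine Finset.mem_filter.2 ⟨mem_cubes.2 ⟨fun i => ?_, hne⟩, ?_⟩
    · calc k ^ m * b i + c i < k ^ m * b i + k ^ m := by gcongr; exact hc i
        _ = k ^ m * (b i + 1) := by ring
        _ ≤ k ^ m * k ^ a := by gcongr; exact hb i
        _ = k ^ (a + m) := by ring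
    · ext i
      simp [Nat.mul_add_div hpos, Nat.div_eq_of_lt (hc i)]
  · intro c _ c' _ h
    ext i
    have := congrFun h i
    simpa using this
  · intro c hc
    obtain ⟨hc, hcb⟩ := Finset.mem_filter.1 hc
    have hne := (mem_cubes.1 hc).2
    have heq : (fun i => k ^ m * b i + c i % k ^ m) = c := by
      ext i
      rw [← congrFun hcb i]
      exact Nat.div_add_mod _ _
    have hlt : ∀ i, c i % k ^ m < k ^ m := fun i => Nat.mod_lt _ hpos
    have hmem : (fun i => c i % k ^ m) ∈ cubes k m (kernelSet k a b Z) := by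
      refine mem_cubes.2 ⟨hlt, ?_⟩
      rw [kernelSet_kernelSet hk a m _ _ hlt, heq]
      exact hne
    exact ⟨_, hmem, heq⟩

theorem div_lt_of_mem_cubes {d : ℕ} {k a m : ℕ} {Z : Set (EuclideanSpace ℝ (Fin d))}
    {c : Fin d → ℕ} (hc : c ∈ cubes k (a + m) Z) (i : Fin d) : c i / k ^ m < k ^ a := by
  refine Nat.div_lt_of_lt_mul ?_
  rw [← pow_add, add_comm]
  exact (mem_cubes.1 hc).1 i

theorem card_cubes_succ {d : ℕ} {k : ℕ} (hk : 0 < k) (m : ℕ)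
    (Z : Set (EuclideanSpace ℝ (Fin d))) :
    (cubes k (m + 1) Z).card =
      ∑ b : Fin d → Fin k, (cubes k m (kernelSet k 1 (fun l => (b l : ℕ)) Z)).card := by
  -- Sort the cubes by their level-1 ancestor, the leading base-`k` digit of each index.
  rw [add_comm m 1, Finset.card_eq_sum_card_fiberwise (f := fun c i => c i / k ^ m)
    (t := Finset.univ.image fun (b : Fin d → Fin k) i => (b i : ℕ)), Finset.sum_image]
  · exact Finset.sum_congr rfl fun b _ =>
      card_filter_cubes_add hk 1 m _ (fun i => by simp) Z
  · intro b _ b' _ h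
    ext i
    exact congrFun h i
  · intro c hc
    have h := div_lt_of_mem_cubes (Finset.mem_coe.1 hc)
    simp only [pow_one] at h
    exact Finset.mem_coe.2 (Finset.mem_image.2 ⟨fun i => ⟨c i / k ^ m, h i⟩, Finset.mem_univ _, rfl⟩)

theorem card_cubes_zero {d : ℕ} {k : ℕ} (hk : 0 < k)
    {Z : Set (EuclideanSpace ℝ (Fin d))} (hZ : Z ⊆ unitCube d) (hne : Z.Nonempty) :
    (cubes k 0 Z).card = 1 :=
  le_antisymm (by simpa using card_cubes_le k 0 Z) (one_le_card_cubes hk 0 hZ hne)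

/-- The column sums of the powers of the copy matrix count the cubes that meet the sets. -/
theorem sum_copyMatrix_pow {d n : ℕ} {k : ℕ} (hk : 0 < k)
    {X : Set (EuclideanSpace ℝ (Fin d))} {Y : Fin n → Set (EuclideanSpace ℝ (Fin d))}
    (hY : Function.Injective Y)
    (hrange : Set.range Y = {Z | Z ∈ kKernel k X ∧ Z.Nonempty}) (m : ℕ) (j : Fin n) :
    ∑ i, (copyMatrix k Y ^ m) i j = (cubes k m (Y j)).card := by
  classical
  have hmem : ∀ j, Y j ∈ kKernel k X ∧ (Y j).Nonempty := fun j => by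
    have : Y j ∈ Set.range Y := ⟨j, rfl⟩
    rwa [hrange] at this
  induction m generalizing j with
  | zero =>
    obtain ⟨⟨a, b, hb, h⟩, hne⟩ := hmem j
    rw [card_cubes_zero hk (h ▸ kernelSet_subset_unitCube hk a b X) hne]
    simp [Matrix.one_apply]
  | succ m ih =>
    have h1 : ∑ i, (copyMatrix k Y ^ (m + 1)) i j =
        ∑ l, (cubes k m (Y l)).card * copyMatrix k Y l j := by
      simp_rw [pow_succ, Matrix.mul_apply]
      rw [Finset.sum_comm]
      simp_rw [← Finset.sum_mul, ih]
    -- A subcube contributes nothing if its kernel set is empty; otherwise that set is `Y l` for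
    -- exactly one `l`.
    have h2 : ∀ b : Fin d → Fin k, (cubes k m (kernelSet k 1 (fun l => (b l : ℕ)) (Y j))).card =
        ∑ l, if kernelSet k 1 (fun l => (b l : ℕ)) (Y j) = Y l then (cubes k m (Y l)).card
          else 0 := by
      intro b
      rcases Set.eq_empty_or_nonempty (kernelSet k 1 (fun l => (b l : ℕ)) (Y j)) with h | h
      · rw [h, cubes_empty, Finset.card_empty]
        symm
        refine Finset.sum_eq_zero fun l _ => if_neg fun hl => ?_
        exact (hmem l).2.ne_empty hl.symm
      · have hr : kernelSet k 1 (fun l => (b l : ℕ)) (Y j) ∈ Set.range Y := by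
          rw [hrange]
          exact ⟨kernelSet_mem_kKernel hk (hmem j).1 1 _ (fun i => by simp), h⟩
        obtain ⟨l, hl⟩ := hr
        rw [← hl]
        simp [hY.eq_iff]
    rw [h1, card_cubes_succ hk, Finset.sum_congr rfl fun b _ => h2 b, Finset.sum_comm]
    refine Finset.sum_congr rfl fun l _ => ?_
    rw [← Finset.sum_filter, Finset.sum_const, smul_eq_mul, mul_comm]
    congr 1
    simp only [copyMatrix, Matrix.of_apply]
    rw [Nat.card_eq_fintype_card, Fintype.card_subtype]

/-! ### Gelfand's formula: spectral radius versus growth of column sums. -/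

section
open scoped Matrix.Norms.Operator
open Filter Topology

theorem map_natCast_pow {n : ℕ} (A : Matrix (Fin n) (Fin n) ℕ) (m : ℕ) :
    A.map (Nat.cast : ℕ → ℂ) ^ m = (A ^ m).map (Nat.cast : ℕ → ℂ) :=
  (map_pow (Nat.castRingHom ℂ).mapMatrix A m).symm

/-- The norm is the largest row sum. Together with the next bound, it is comparable to the column
sums up to factors depending only on `n`, which disappear in `m`-th roots. -/
theorem norm_map_natCast_le {n : ℕ} (A : Matrix (Fin n) (Fin n) ℕ) :
    ‖A.map (Nat.cast : ℕ → ℂ)‖ ≤ ∑ j, ∑ i, (A i j : ℝ) := by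
  rw [Finset.sum_comm]
  have h : ‖A.map (Nat.cast : ℕ → ℂ)‖₊ ≤ ∑ i, ∑ j, (A i j : NNReal) := by
    rw [Matrix.linfty_opNNNorm_def]
    refine Finset.sup_le fun i _ => ?_
    refine le_trans (le_of_eq ?_)
      (Finset.single_le_sum (f := fun i => ∑ j, (A i j : NNReal)) (fun _ _ => zero_le)
        (Finset.mem_univ i))
    simp
  exact_mod_cast h

theorem sum_le_norm_map_natCast {n : ℕ} (A : Matrix (Fin n) (Fin n) ℕ) (j : Fin n) :
    ∑ i, (A i j : ℝ) ≤ n * ‖A.map (Nat.cast : ℕ → ℂ)‖ := by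
  have h : ∀ i, (A i j : NNReal) ≤ ‖A.map (Nat.cast : ℕ → ℂ)‖₊ := fun i => by
    rw [Matrix.linfty_opNNNorm_def]
    refine le_trans ?_ (Finset.le_sup (f := fun i => ∑ j, ‖A.map (Nat.cast : ℕ → ℂ) i j‖₊)
      (Finset.mem_univ i))
    refine le_trans (le_of_eq ?_)
      (Finset.single_le_sum (f := fun j => ‖A.map (Nat.cast : ℕ → ℂ) i j‖₊)
        (fun _ _ => zero_le) (Finset.mem_univ j))
    simp
  have h' : ∑ i, (A i j : ℝ) ≤ ∑ _i : Fin n, ‖A.map (Nat.cast : ℕ → ℂ)‖ :=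
    Finset.sum_le_sum fun i _ => by exact_mod_cast h i
  simpa using h'

theorem natSpectralRadius_ne_top {n : ℕ} (A : Matrix (Fin n) (Fin n) ℕ) :
    natSpectralRadius A ≠ ⊤ := by
  have h := spectrum.spectralRadius_le_pow_nnnorm_pow_one_div ℂ (A.map (Nat.cast : ℕ → ℂ)) 0
  refine ne_top_of_le_ne_top ?_ h
  simp only [Nat.cast_zero, zero_add, div_one, ENNReal.rpow_one]
  exact ENNReal.mul_ne_top ENNReal.coe_ne_top ENNReal.coe_ne_top

theorem natSpectralRadius_le_of_sum_le {n : ℕ} (A : Matrix (Fin n) (Fin n) ℕ) {C q : ℝ}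
    (hq : 0 < q) (h : ∀ m j, ∑ i, ((A ^ m) i j : ℝ) ≤ C * q ^ m) :
    natSpectralRadius A ≤ ENNReal.ofReal q := by
  -- `C` has no assumed sign; the `+ 1` keeps `D` positive, so that `D ^ (1 / m) → 1`.
  set D : ℝ := n * |C| + 1
  have hD : 0 < D := by positivity
  have hnorm : ∀ m, ‖A.map (Nat.cast : ℕ → ℂ) ^ m‖ ≤ D * q ^ m := fun m => by
    rw [map_natCast_pow]
    have hp : 0 < q ^ m := by positivity
    calc _ ≤ ∑ j, ∑ i, ((A ^ m) i j : ℝ) := norm_map_natCast_le _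
      _ ≤ ∑ _j : Fin n, C * q ^ m := Finset.sum_le_sum fun j _ => h m j
      _ = n * C * q ^ m := by simp; ring
      _ ≤ D * q ^ m := by
        have := mul_le_mul_of_nonneg_left (le_abs_self C) (Nat.cast_nonneg (α := ℝ) n)
        gcongr
        linarith
  have hlim : Tendsto (fun m : ℕ => ENNReal.ofReal (D ^ (1 / (m : ℝ)) * q)) atTop
      (𝓝 (ENNReal.ofReal q)) := by
    refine ENNReal.tendsto_ofReal ?_
    have h1 : Tendsto (fun m : ℕ => D ^ (1 / (m : ℝ))) atTop (𝓝 (D ^ (0 : ℝ))) :=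
      tendsto_const_nhds.rpow tendsto_one_div_atTop_nhds_zero_nat (Or.inl hD.ne')
    simpa using h1.mul_const q
  refine le_of_tendsto_of_tendsto
    (spectrum.pow_norm_pow_one_div_tendsto_nhds_spectralRadius _) hlim ?_
  filter_upwards [eventually_ge_atTop 1] with m hm
  refine ENNReal.ofReal_le_ofReal ?_
  calc _ ≤ (D * q ^ m) ^ (1 / (m : ℝ)) :=
        Real.rpow_le_rpow (norm_nonneg _) (hnorm m) (by positivity)
    _ = _ := by
      rw [Real.mul_rpow hD.le (by positivity), one_div, Real.pow_rpow_inv_natCast hq.le (by omega)]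

theorem eventually_sum_le_of_natSpectralRadius_lt {n : ℕ} (A : Matrix (Fin n) (Fin n) ℕ) {q : ℝ}
    (h : natSpectralRadius A < ENNReal.ofReal q) :
    ∀ᶠ m : ℕ in atTop, ∀ j, ∑ i, ((A ^ m) i j : ℝ) ≤ n * q ^ m := by
  have hlim := spectrum.pow_norm_pow_one_div_tendsto_nhds_spectralRadius
    (A.map (Nat.cast : ℕ → ℂ))
  filter_upwards [hlim.eventually (gt_mem_nhds h), eventually_ge_atTop 1] with m hm hm1 j
  have hm' : ‖A.map (Nat.cast : ℕ → ℂ) ^ m‖ ^ (1 / (m : ℝ)) < q :=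
    (ENNReal.ofReal_lt_ofReal_iff_of_nonneg (by positivity)).1 hm
  have hn : ‖A.map (Nat.cast : ℕ → ℂ) ^ m‖ ≤ q ^ m := by
    have := pow_le_pow_left₀ (by positivity) hm'.le m
    rwa [one_div, Real.rpow_inv_natCast_pow (norm_nonneg _) (by omega)] at this
  rw [map_natCast_pow] at hn
  exact (sum_le_norm_map_natCast _ j).trans (by gcongr)

end

/-! ### Comparing ball covers with grid cubes. -/

/-- The indices of grid cubes of level `a` that can come within distance `2 / k ^ a` of `x`. -/
noncomputable def nearCubes {d : ℕ} (k a : ℕ) (x : EuclideanSpace ℝ (Fin d)) :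
    Finset (Fin d → ℕ) :=
  Fintype.piFinset fun i =>
    -- A cube with a point in the ball has `k ^ a * x i - 3 < b i < k ^ a * x i + 2`, leaving at
    -- most five values per coordinate.
    (Finset.Icc (⌈(k : ℝ) ^ a * x i⌉₊ - 3) (⌈(k : ℝ) ^ a * x i⌉₊ + 1)).filter (· < k ^ a)

theorem card_nearCubes_le {d : ℕ} (k a : ℕ) (x : EuclideanSpace ℝ (Fin d)) :
    (nearCubes k a x).card ≤ 5 ^ d := by
  rw [nearCubes, Fintype.card_piFinset]
  refine (Finset.prod_le_pow_card _ _ 5 fun i _ => ?_).trans (by simp)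
  refine (Finset.card_filter_le _ _).trans ?_
  rw [Nat.card_Icc]
  omega

theorem mem_nearCubes {d : ℕ} {k a : ℕ} (hk : 0 < k) {x z : EuclideanSpace ℝ (Fin d)}
    {b : Fin d → ℕ} (hb : ∀ i, b i < k ^ a) (hz : z ∈ gridCube k a b)
    (hx : z ∈ Metric.ball x (2 * ((k : ℝ) ^ a)⁻¹)) : b ∈ nearCubes k a x := by
  have hpos : (0 : ℝ) < (k : ℝ) ^ a := by positivity
  rw [nearCubes, Fintype.mem_piFinset]
  intro i
  obtain ⟨h1, h2⟩ := hz i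
  rw [div_le_iff₀ hpos] at h1
  rw [le_div_iff₀ hpos] at h2
  have h3 : |z i - x i| < 2 * ((k : ℝ) ^ a)⁻¹ := by
    have h := PiLp.norm_apply_le (z - x) i
    rw [← dist_eq_norm, Real.norm_eq_abs] at h
    exact h.trans_lt hx
  rw [← div_eq_mul_inv, lt_div_iff₀ hpos, ← abs_of_pos hpos, ← abs_mul, abs_lt] at h3
  rw [Finset.mem_filter, Finset.mem_Icc]
  refine ⟨⟨?_, ?_⟩, hb i⟩
  · rw [Nat.sub_le_iff_le_add, Nat.ceil_le]
    push_cast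
    linarith [h3.1]
  · have h := Nat.le_ceil ((k : ℝ) ^ a * x i)
    have : (b i : ℝ) < ((⌈(k : ℝ) ^ a * x i⌉₊ + 2 : ℕ) : ℝ) := by
      push_cast
      linarith [h3.2]
    have := Nat.cast_lt.1 this
    omega

/-- Dropping the last `m` base-`k` digits of the index gives the level-`a` ancestor. -/
theorem gridCube_subset_gridCube_div {d : ℕ} {k : ℕ} (hk : 0 < k) (a m : ℕ) (c : Fin d → ℕ) :
    gridCube k (a + m) c ⊆ gridCube k a fun i => c i / k ^ m := by
  intro z hz i
  have ha : (0 : ℝ) < (k : ℝ) ^ a := by positivity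
  have hm : (0 : ℝ) < (k : ℝ) ^ m := by positivity
  obtain ⟨h1, h2⟩ := hz i
  rw [div_le_iff₀ (by positivity), pow_add] at h1
  rw [le_div_iff₀ (by positivity), pow_add] at h2
  rw [Set.mem_Icc, div_le_iff₀ ha, le_div_iff₀ ha]
  have h3 : ((c i / k ^ m : ℕ) : ℝ) * (k : ℝ) ^ m ≤ c i := by
    exact_mod_cast Nat.div_mul_le_self (c i) (k ^ m)
  have h4 : (c i : ℝ) + 1 ≤ (((c i / k ^ m : ℕ) : ℝ) + 1) * (k : ℝ) ^ m := by
    exact_mod_cast Nat.lt_div_mul_add (b := k ^ m) (a := c i) (by positivity) |>.trans_eq (by ring)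
  constructor
  · refine le_of_mul_le_mul_right ?_ hm
    linarith
  · refine le_of_mul_le_mul_right ?_ hm
    linarith

/-- A level-`m` cube meeting `Z` has a point of `Z` in some ball `s`, so its level-`a s` ancestor is
near `x s`; the descendants of that ancestor are counted by a kernel set. -/
theorem card_cubes_le_of_cover {d : ℕ} {k : ℕ} (hk : 0 < k) {ι : Type*}
    {Z : Set (EuclideanSpace ℝ (Fin d))} (T : Finset ι) (x : ι → EuclideanSpace ℝ (Fin d))
    (a : ι → ℕ) (hZ : Z ⊆ ⋃ s ∈ T, Metric.ball (x s) (2 * ((k : ℝ) ^ a s)⁻¹)) (m : ℕ)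
    (hm : ∀ s ∈ T, a s ≤ m) :
    (cubes k m Z).card ≤
      ∑ s ∈ T, ∑ b ∈ nearCubes k (a s) (x s),
        (cubes k (m - a s) (kernelSet k (a s) b Z)).card := by
  classical
  have hsub : cubes k m Z ⊆ T.biUnion fun s => (nearCubes k (a s) (x s)).biUnion fun b =>
      (cubes k m Z).filter fun c => (fun i => c i / k ^ (m - a s)) = b := by
    intro c hc
    obtain ⟨z, hz, hzc⟩ := (mem_cubes.1 hc).2.of_image
    obtain ⟨s, hs, hzs⟩ := Set.mem_iUnion₂.1 (hZ hz)
    have hadd : m = a s + (m - a s) := by have := hm s hs; omega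
    refine Finset.mem_biUnion.2 ⟨s, hs, Finset.mem_biUnion.2 ⟨_, ?_, Finset.mem_filter.2 ⟨hc, rfl⟩⟩⟩
    rw [hadd] at hc hzc
    exact mem_nearCubes hk (fun i => div_lt_of_mem_cubes hc i)
      (gridCube_subset_gridCube_div hk _ _ _ hzc) hzs
  refine (Finset.card_le_card hsub).trans (Finset.card_biUnion_le.trans ?_)
  refine Finset.sum_le_sum fun s hs => Finset.card_biUnion_le.trans ?_
  refine Finset.sum_le_sum fun b hb => le_of_eq ?_
  have hadd : m = a s + (m - a s) := by have := hm s hs; omega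
  have hb' : ∀ i, b i < k ^ a s := fun i =>
    (Finset.mem_filter.1 (Fintype.mem_piFinset.1 hb i)).2
  have h := card_filter_cubes_add hk (a s) (m - a s) b hb' Z
  rwa [← hadd] at h

/-- Choose `a` with `k ^ (-(a + 1)) < D ≤ k ^ (-a)`; then `k ^ (-a) ≤ k * D`. If `D = 0`, a large
`a` fits into `ε`. The bound `D ≤ 1 / k` forces `1 ≤ a`, which makes the later recursion descend. -/
theorem exists_level {k : ℕ} (hk : 2 ≤ k) {t : ℝ} (ht : 0 < t) {D : ℝ} (hD0 : 0 ≤ D)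
    (hD : D ≤ (k : ℝ)⁻¹) {ε : ℝ} (hε : 0 < ε) :
    ∃ a : ℕ, 1 ≤ a ∧ D ≤ ((k : ℝ) ^ a)⁻¹ ∧
      (((k : ℝ) ^ t) ^ a)⁻¹ ≤ (k : ℝ) ^ t * D ^ t + ε := by
  have hk1 : (1 : ℝ) < k := by exact_mod_cast hk
  have hk0 : (0 : ℝ) < k := by linarith
  have hinv : (k : ℝ)⁻¹ < 1 := inv_lt_one_of_one_lt₀ hk1
  have hinv0 : 0 < (k : ℝ)⁻¹ := inv_pos.2 hk0
  rcases hD0.eq_or_lt with rfl | hpos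
  · have hq : ((k : ℝ) ^ t)⁻¹ < 1 := inv_lt_one_of_one_lt₀ (Real.one_lt_rpow hk1 ht)
    obtain ⟨a, ha⟩ := exists_pow_lt_of_lt_one hε hq
    refine ⟨a + 1, by omega, by positivity, ?_⟩
    rw [Real.zero_rpow ht.ne', mul_zero, zero_add, ← inv_pow]
    exact (pow_le_pow_of_le_one (by positivity) hq.le (Nat.le_succ a)).trans ha.le
  · obtain ⟨a, h1, h2⟩ := exists_nat_pow_near_of_lt_one hpos (hD.trans hinv.le) hinv0 hinv
    refine ⟨a, ?_, by rwa [← inv_pow], ?_⟩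
    · by_contra! h
      have : a = 0 := by omega
      subst this
      simp only [zero_add, pow_one] at h1
      linarith
    · have h3 : ((k : ℝ) ^ a)⁻¹ ≤ k * D := by
        calc ((k : ℝ) ^ a)⁻¹ = k * (k : ℝ)⁻¹ ^ (a + 1) := by
              rw [inv_pow, pow_succ]
              field_simp
          _ ≤ k * D := by gcongr
      have h4 := Real.rpow_le_rpow (by positivity) h3 ht.le
      rw [Real.mul_rpow hk0.le hD0, Real.inv_rpow (by positivity)] at h4
      have h5 : ((k : ℝ) ^ a) ^ t = ((k : ℝ) ^ t) ^ a := by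
        rw [← Real.rpow_natCast, ← Real.rpow_natCast, ← Real.rpow_mul hk0.le,
          ← Real.rpow_mul hk0.le, mul_comm]
      rw [h5] at h4
      linarith

open MeasureTheory in
/-- A compact set of zero `t`-dimensional Hausdorff measure has finite covers by balls of radius
`2 / k ^ a`, `a ≥ 1`, for which the sum of the `k ^ (-a t)` is small. -/
theorem exists_finite_cover {d : ℕ} {k : ℕ} (hk : 2 ≤ k) {t : ℝ} (ht : 0 < t)
    {Z : Set (EuclideanSpace ℝ (Fin d))} (hZ : IsCompact Z) (h0 : μH[t] Z = 0)
    {δ : ℝ} (hδ : 0 < δ) :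
    ∃ (T : Finset ℕ) (x : ℕ → EuclideanSpace ℝ (Fin d)) (a : ℕ → ℕ), (∀ s, 1 ≤ a s) ∧
      Z ⊆ ⋃ s ∈ T, Metric.ball (x s) (2 * ((k : ℝ) ^ a s)⁻¹) ∧
      ∑ s ∈ T, (((k : ℝ) ^ t) ^ a s)⁻¹ ≤ δ := by
  have hk1 : (1 : ℝ) < k := by exact_mod_cast hk
  have hk0 : (0 : ℝ) < k := by linarith
  set q : ℝ := (k : ℝ) ^ t
  have hq0 : 0 < q := by positivity
  -- Half of `δ` pays for the diameters after the factor `q`; the other half is spread as the errors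
  -- `δ / 4 / 2 ^ n`.
  set η : ℝ := δ / 2 / q
  have hη : 0 < η := by positivity
  have hr : (0 : ℝ≥0∞) < ENNReal.ofReal (k : ℝ)⁻¹ := ENNReal.ofReal_pos.2 (inv_pos.2 hk0)
  have hinf := (Measure.hausdorffMeasure_apply t Z).symm.trans h0
  have hinf' := le_antisymm ((le_iSup₂ (f := fun (r : ℝ≥0∞) (_ : 0 < r) =>
    ⨅ (t' : ℕ → Set (EuclideanSpace ℝ (Fin d))) (_ : Z ⊆ ⋃ n, t' n)
      (_ : ∀ n, Metric.ediam (t' n) ≤ r), ∑' n, ⨆ _ : (t' n).Nonempty, Metric.ediam (t' n) ^ t)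
    _ hr).trans hinf.le) zero_le
  have hlt := hinf'.trans_lt (ENNReal.ofReal_pos.2 hη)
  simp only [iInf_lt_iff] at hlt
  obtain ⟨u, hu, hud, hsum⟩ := hlt
  set g : ℕ → ℝ≥0∞ := fun n => ⨆ _ : (u n).Nonempty, Metric.ediam (u n) ^ t
  have hg : ∀ n, g n ≠ ⊤ := ENNReal.ne_top_of_tsum_ne_top hsum.ne_top
  have hex : ∀ n, ∃ (x : EuclideanSpace ℝ (Fin d)) (a : ℕ), 1 ≤ a ∧
      u n ⊆ Metric.ball x (2 * ((k : ℝ) ^ a)⁻¹) ∧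
      (q ^ a)⁻¹ ≤ q * (g n).toReal + δ / 4 / 2 ^ n := by
    intro n
    have hε : 0 < δ / 4 / 2 ^ n := by positivity
    rcases (u n).eq_empty_or_nonempty with hun | ⟨x, hx⟩
    -- An empty piece still gets a ball, chosen with `D = 0` so that it costs only the error term.
    · obtain ⟨a, ha, -, h⟩ := exists_level hk ht le_rfl (inv_pos.2 hk0).le hε
      refine ⟨0, a, ha, by simp [hun], ?_⟩
      rw [Real.zero_rpow ht.ne', mul_zero, zero_add] at h
      have : 0 ≤ q * (g n).toReal := by positivity
      linarith
    · have hfin : Metric.ediam (u n) ≠ ⊤ := ne_top_of_le_ne_top ENNReal.ofReal_ne_top (hud n)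
      obtain ⟨a, ha, hD, h⟩ := exists_level hk ht (D := Metric.diam (u n)) Metric.diam_nonneg
        (ENNReal.toReal_le_of_le_ofReal (inv_pos.2 hk0).le (hud n)) hε
      refine ⟨x, a, ha, fun y hy => ?_, ?_⟩
      · have h1 := Metric.dist_le_diam_of_mem
          (Metric.isBounded_iff_ediam_ne_top.2 hfin) hy hx
        have : 0 < ((k : ℝ) ^ a)⁻¹ := by positivity
        rw [Metric.mem_ball]
        linarith
      · have hgn : (g n).toReal = Metric.diam (u n) ^ t := by
          simp only [g, iSup_pos (show (u n).Nonempty from ⟨x, hx⟩)]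
          rw [← ENNReal.toReal_rpow, Metric.diam]
        rw [hgn]
        exact h
  choose x a ha hball hle using hex
  obtain ⟨T, hT⟩ := hZ.elim_finite_subcover
    (fun s => Metric.ball (x s) (2 * ((k : ℝ) ^ a s)⁻¹)) (fun s => Metric.isOpen_ball)
    (hu.trans (Set.iUnion_mono hball))
  refine ⟨T, x, a, ha, hT, ?_⟩
  have h1 : ∑ s ∈ T, (g s).toReal ≤ η := by
    rw [← ENNReal.toReal_sum fun s _ => hg s]
    exact ENNReal.toReal_le_of_le_ofReal hη.le ((ENNReal.sum_le_tsum T).trans hsum.le)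
  have h2 : ∑ s ∈ T, δ / 4 / 2 ^ s ≤ δ / 2 := by
    have := Summable.sum_le_tsum T (fun s _ => by positivity) (summable_geometric_two' (δ / 4))
    have h4 : ∑' s : ℕ, δ / 4 / 2 / 2 ^ s = δ / 4 := tsum_geometric_two' _
    have h5 : ∑ s ∈ T, δ / 4 / 2 ^ s = 2 * ∑ s ∈ T, δ / 4 / 2 / 2 ^ s := by
      rw [Finset.mul_sum]
      exact Finset.sum_congr rfl fun s _ => by ring
    linarith
  calc ∑ s ∈ T, (q ^ a s)⁻¹ ≤ ∑ s ∈ T, (q * (g s).toReal + δ / 4 / 2 ^ s) :=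
        Finset.sum_le_sum fun s _ => hle s
    _ = q * ∑ s ∈ T, (g s).toReal + ∑ s ∈ T, δ / 4 / 2 ^ s := by
        rw [Finset.sum_add_distrib, Finset.mul_sum]
    _ ≤ q * η + δ / 2 := by gcongr
    _ = δ := by
        simp only [η]
        field_simp
        ring

theorem dimH_le_of_mem_kKernel {d : ℕ} {k : ℕ} {X Z : Set (EuclideanSpace ℝ (Fin d))}
    (hZ : Z ∈ kKernel k X) : dimH Z ≤ dimH X := by
  obtain ⟨a, b, -, rfl⟩ := hZ
  exact dimH_kernelSet_le k a b X

theorem isCompact_of_mem_kKernel {d : ℕ} {k : ℕ} (hk : 0 < k)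
    {X Z : Set (EuclideanSpace ℝ (Fin d))} (hX : IsCompact X) (hZ : Z ∈ kKernel k X) :
    IsCompact Z := by
  obtain ⟨a, b, -, rfl⟩ := hZ
  exact isCompact_kernelSet hk a b hX

/-! ### Cube counts above the Hausdorff dimension. -/

open MeasureTheory in
/-- Above the Hausdorff dimension, the numbers of cubes that meet the sets of the kernel grow at
most like `k ^ (t m)`. -/
theorem exists_card_cubes_le {d : ℕ} {k : ℕ} (hk : 2 ≤ k)
    {X : Set (EuclideanSpace ℝ (Fin d))} (hX : IsSelfSimilarSet k X) {t : ℝ} (ht : 0 < t)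
    (hdim : dimH X < ENNReal.ofReal t) :
    ∃ C : ℝ, ∀ m, ∀ Z ∈ kKernel k X, ((cubes k m Z).card : ℝ) ≤ C * ((k : ℝ) ^ t) ^ m := by
  have hk0 : 0 < k := by omega
  have hk1 : (1 : ℝ) < k := by exact_mod_cast hk
  set q : ℝ := (k : ℝ) ^ t
  have hq1 : 1 < q := Real.one_lt_rpow hk1 ht
  have hq0 : 0 < q := by linarith
  have hcov : ∀ Z : kKernel k X, ∃ (T : Finset ℕ) (x : ℕ → EuclideanSpace ℝ (Fin d)) (a : ℕ → ℕ),
      (∀ s, 1 ≤ a s) ∧ Z.1 ⊆ ⋃ s ∈ T, Metric.ball (x s) (2 * ((k : ℝ) ^ a s)⁻¹) ∧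
      -- The threshold cancels the at most `5 ^ d` near cubes per ball.
      ∑ s ∈ T, (q ^ a s)⁻¹ ≤ ((5 : ℝ) ^ d)⁻¹ := fun Z => by
    refine exists_finite_cover hk ht (isCompact_of_mem_kKernel hk0 hX.isCompact Z.2) ?_
      (by positivity)
    have h := hausdorffMeasure_of_dimH_lt
      (d := ⟨t, ht.le⟩) (s := Z.1) ((dimH_le_of_mem_kKernel Z.2).trans_lt
        (hdim.trans_eq (ENNReal.ofReal_eq_coe_nnreal ht.le)))
    exact h
  choose T x a ha hT hsum using hcov
  have := hX.finite_kKernel.fintype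
  -- Finiteness of the kernel gives one bound for the levels of all the chosen covers. Up to level
  -- `M` the trivial count gives `C`; from there on the cover recursion applies.
  set M : ℕ := Finset.univ.sup fun Z : kKernel k X => (T Z).sup (a Z)
  have hM : ∀ Z, ∀ s ∈ T Z, a Z s ≤ M := fun Z s hs =>
    (Finset.le_sup (f := a Z) hs).trans
      (Finset.le_sup (f := fun Z : kKernel k X => (T Z).sup (a Z)) (Finset.mem_univ Z))
  set C : ℝ := ((k : ℝ) ^ M) ^ d
  have hC : 0 ≤ C := by positivity
  refine ⟨C, fun m => ?_⟩
  induction m using Nat.strong_induction_on with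
  | _ m ih =>
    intro Z hZ
    rcases le_total m M with hm | hm
    · calc ((cubes k m Z).card : ℝ) ≤ ((k : ℝ) ^ m) ^ d := by exact_mod_cast card_cubes_le k m Z
        _ ≤ C := by
          exact pow_le_pow_left₀ (by positivity) (pow_le_pow_right₀ hk1.le hm) d
        _ ≤ C * q ^ m := le_mul_of_one_le_right hC (one_le_pow₀ hq1.le)
    · have h := card_cubes_le_of_cover hk0 (T ⟨Z, hZ⟩) (x ⟨Z, hZ⟩) (a ⟨Z, hZ⟩) (hT ⟨Z, hZ⟩) m
        fun s hs => (hM _ s hs).trans hm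
      have h' : ((cubes k m Z).card : ℝ) ≤ ∑ s ∈ T ⟨Z, hZ⟩,
          ∑ b ∈ nearCubes k (a ⟨Z, hZ⟩ s) (x ⟨Z, hZ⟩ s),
            ((cubes k (m - a ⟨Z, hZ⟩ s) (kernelSet k (a ⟨Z, hZ⟩ s) b Z)).card : ℝ) := by
        exact_mod_cast h
      refine h'.trans ?_
      calc _ ≤ ∑ s ∈ T ⟨Z, hZ⟩, (5 : ℝ) ^ d * (C * q ^ m * (q ^ a ⟨Z, hZ⟩ s)⁻¹) := by
            refine Finset.sum_le_sum fun s hs => ?_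
            have hs1 := ha ⟨Z, hZ⟩ s
            have hsm := (hM _ s hs).trans hm
            refine (Finset.sum_le_card_nsmul _ _ (C * q ^ m * (q ^ a ⟨Z, hZ⟩ s)⁻¹)
              fun b hb => ?_).trans ?_
            · have hb' : ∀ i, b i < k ^ a ⟨Z, hZ⟩ s := fun i =>
                (Finset.mem_filter.1 (Fintype.mem_piFinset.1 hb i)).2
              refine (ih (m - a ⟨Z, hZ⟩ s) (by omega) _
                (kernelSet_mem_kKernel hk0 hZ _ b hb')).trans (le_of_eq ?_)
              rw [pow_sub₀ q hq0.ne' hsm, mul_assoc]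
            · rw [nsmul_eq_mul]
              gcongr
              exact_mod_cast card_nearCubes_le _ _ _
        _ = (5 : ℝ) ^ d * (C * q ^ m) * ∑ s ∈ T ⟨Z, hZ⟩, (q ^ a ⟨Z, hZ⟩ s)⁻¹ := by
            rw [Finset.mul_sum]
            exact Finset.sum_congr rfl fun s _ => by ring
        _ ≤ (5 : ℝ) ^ d * (C * q ^ m) * ((5 : ℝ) ^ d)⁻¹ := by
            gcongr
            exact hsum _
        _ = C * q ^ m := by field_simp

/-! ### Dimension bound from cube counts. -/

theorem ediam_gridCube_le {d : ℕ} {k : ℕ} (hk : 0 < k) (m : ℕ) (c : Fin d → ℕ) :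
    Metric.ediam (gridCube k m c) ≤ ENNReal.ofReal (d * ((k : ℝ) ^ m)⁻¹) := by
  have hpos : (0 : ℝ) < (k : ℝ) ^ m := by positivity
  refine Metric.ediam_le fun x hx y hy => ?_
  rw [edist_dist]
  refine ENNReal.ofReal_le_ofReal ?_
  have hi : ∀ i, ‖(x - y) i‖ ≤ ((k : ℝ) ^ m)⁻¹ := fun i => by
    obtain ⟨h1, h2⟩ := hx i
    obtain ⟨h3, h4⟩ := hy i
    rw [add_div, one_div] at h2 h4
    rw [PiLp.sub_apply, Real.norm_eq_abs, abs_le]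
    constructor <;> linarith
  -- Summing over coordinates gives the crude factor `d` instead of `√d`; constants do not affect
  -- the dimension.
  have hsum : x - y = ∑ i, EuclideanSpace.single i ((x - y) i) := by
    ext j
    simp [Finset.sum_apply, Pi.single_apply]
  rw [dist_eq_norm, hsum]
  refine (norm_sum_le _ _).trans
    ((Finset.sum_le_card_nsmul _ _ (((k : ℝ) ^ m)⁻¹) fun i _ => ?_).trans ?_)
  · rw [PiLp.norm_single]
    exact hi i
  · simp

open MeasureTheory Filter Topology in
/-- If about `k ^ (t m)` cubes of level `m` meet `Z`, then `Z` has dimension at most `t`. -/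
theorem dimH_le_of_card_cubes_le {d : ℕ} {k : ℕ} (hk : 2 ≤ k)
    {Z : Set (EuclideanSpace ℝ (Fin d))} (hZ : Z ⊆ unitCube d) {t C : ℝ} (ht : 0 ≤ t)
    (h : ∀ᶠ m in atTop, ((cubes k m Z).card : ℝ) ≤ C * ((k : ℝ) ^ t) ^ m) :
    dimH Z ≤ ENNReal.ofReal t := by
  have hk0 : 0 < k := by omega
  have hk1 : (1 : ℝ) < k := by exact_mod_cast hk
  have hr : Tendsto (fun m : ℕ => ENNReal.ofReal (d * ((k : ℝ) ^ m)⁻¹)) atTop (𝓝 0) := by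
    have h1 : Tendsto (fun m : ℕ => (d : ℝ) * ((k : ℝ) ^ m)⁻¹) atTop (𝓝 (d * 0)) :=
      (tendsto_inv_atTop_zero.comp (tendsto_pow_atTop_atTop_of_one_lt hk1)).const_mul _
    simpa using ENNReal.tendsto_ofReal h1
  have hμ := Measure.hausdorffMeasure_le_liminf_sum t Z _ hr
    (fun m (c : cubes k m Z) => gridCube k m c.1)
    (Eventually.of_forall fun m c => ediam_gridCube_le hk0 m c.1)
    (Eventually.of_forall fun m => subset_iUnion_cubes hk0 m hZ)
  have hbound : μH[t] Z ≤ ENNReal.ofReal (C * (d : ℝ) ^ t) := by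
    refine hμ.trans ((liminf_le_liminf (v := fun _ => ENNReal.ofReal (C * (d : ℝ) ^ t)) ?_).trans_eq
      (liminf_const _))
    filter_upwards [h] with m hm
    have hpos : (0 : ℝ) < (k : ℝ) ^ m := by positivity
    have hd : 0 ≤ (d : ℝ) * ((k : ℝ) ^ m)⁻¹ := by positivity
    calc _ ≤ ∑ _c : cubes k m Z, ENNReal.ofReal (((d : ℝ) * ((k : ℝ) ^ m)⁻¹) ^ t) := by
          refine Finset.sum_le_sum fun c _ => ?_
          rw [← ENNReal.ofReal_rpow_of_nonneg hd ht]
          exact ENNReal.rpow_le_rpow (ediam_gridCube_le hk0 m c.1) ht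
      _ = ENNReal.ofReal ((cubes k m Z).card * ((d : ℝ) * ((k : ℝ) ^ m)⁻¹) ^ t) := by
          rw [ENNReal.ofReal_mul (by positivity)]
          simp
      _ ≤ ENNReal.ofReal (C * (d : ℝ) ^ t) := by
          refine ENNReal.ofReal_le_ofReal ?_
          have h5 : ((k : ℝ) ^ m) ^ t = ((k : ℝ) ^ t) ^ m := by
            rw [← Real.rpow_natCast, ← Real.rpow_natCast, ← Real.rpow_mul (by positivity),
              ← Real.rpow_mul (by positivity), mul_comm]
          have hq : 0 < ((k : ℝ) ^ t) ^ m := by positivity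
          rw [Real.mul_rpow (by positivity) (by positivity), Real.inv_rpow hpos.le, h5]
          calc _ ≤ C * ((k : ℝ) ^ t) ^ m * ((d : ℝ) ^ t * (((k : ℝ) ^ t) ^ m)⁻¹) := by gcongr
            _ = C * (d : ℝ) ^ t := by field_simp
  have := dimH_le_of_hausdorffMeasure_ne_top (d := ⟨t, ht⟩) (s := Z)
    (ne_top_of_le_ne_top ENNReal.ofReal_ne_top hbound)
  exact this.trans_eq (ENNReal.ofReal_eq_coe_nnreal ht).symm

/-! ### The dimension formula. -/

open Filter Topology in
theorem proposition1 {d k n : ℕ} (hk : 2 ≤ k)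
    (X : Set (EuclideanSpace ℝ (Fin d))) (hX : IsSelfSimilarSet k X) (hne : X.Nonempty)
    (Y : Fin n → Set (EuclideanSpace ℝ (Fin d))) (hY : Function.Injective Y)
    (hrange : Set.range Y = {Z | Z ∈ kKernel k X ∧ Z.Nonempty}) :
    1 ≤ natSpectralRadius (copyMatrix k Y) ∧ natSpectralRadius (copyMatrix k Y) ≠ ⊤ ∧
      dimH X = ENNReal.ofReal (Real.logb k (natSpectralRadius (copyMatrix k Y)).toReal) := by
  have hk0 : 0 < k := by omega
  have hk1 : (1 : ℝ) < k := by exact_mod_cast hk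
  have hkpos : (0 : ℝ) < k := by linarith
  obtain ⟨j, rfl⟩ : X ∈ Set.range Y := by
    rw [hrange]
    exact ⟨self_mem_kKernel hk0 hX.subset_unitCube, hne⟩
  have hmem : ∀ i, Y i ∈ kKernel k (Y j) := fun i => by
    have h : Y i ∈ Set.range Y := ⟨i, rfl⟩
    rw [hrange] at h
    exact h.1
  have hcount : ∀ m i, ∑ l, ((copyMatrix k Y ^ m) l i : ℝ) = (cubes k m (Y i)).card := fun m i => by
    exact_mod_cast sum_copyMatrix_pow hk0 hY hrange m i
  have htop := natSpectralRadius_ne_top (copyMatrix k Y)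
  have hupper : ∀ {q : ℝ}, natSpectralRadius (copyMatrix k Y) < ENNReal.ofReal q →
      ∀ᶠ m : ℕ in atTop, ((cubes k m (Y j)).card : ℝ) ≤ n * q ^ m := fun hq => by
    filter_upwards [eventually_sum_le_of_natSpectralRadius_lt _ hq] with m hm
    rw [← hcount]
    exact hm j
  -- If `ρ(A) < 1`, the cube counts would tend to zero, although a non-empty set always meets a
  -- cube.
  have hone : 1 ≤ natSpectralRadius (copyMatrix k Y) := by
    by_contra! h
    obtain ⟨q, hq, hq1⟩ := ENNReal.lt_iff_exists_nnreal_btwn.1 h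
    have hq1' : (q : ℝ) < 1 := by exact_mod_cast hq1
    have hlim : Tendsto (fun m : ℕ => (n : ℝ) * (q : ℝ) ^ m) atTop (𝓝 (n * 0)) :=
      (tendsto_pow_atTop_nhds_zero_of_lt_one q.2 hq1').const_mul _
    rw [mul_zero] at hlim
    rw [← ENNReal.ofReal_coe_nnreal] at hq
    obtain ⟨m, h1, h2⟩ := ((hupper hq).and (hlim.eventually (gt_mem_nhds one_pos))).exists
    have h3 : (1 : ℝ) ≤ (cubes k m (Y j)).card := by
      exact_mod_cast one_le_card_cubes hk0 m hX.subset_unitCube hne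
    linarith
  refine ⟨hone, htop, ?_⟩
  set r : ℝ := (natSpectralRadius (copyMatrix k Y)).toReal with hr
  have hofr : natSpectralRadius (copyMatrix k Y) = ENNReal.ofReal r :=
    (ENNReal.ofReal_toReal htop).symm
  have hr1 : 1 ≤ r := by
    rw [hofr] at hone
    exact ENNReal.one_le_ofReal.1 hone
  have hr0 : 0 < r := by linarith
  have hlog : 0 ≤ Real.logb k r := Real.logb_nonneg hk1 hr1
  apply le_antisymm
  -- Every `t` above `log_k ρ(A)` satisfies `ρ(A) < k ^ t`, so it bounds the dimension.
  · refine le_of_forall_gt_imp_ge_of_dense fun s hs => ?_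
    obtain ⟨t, ht, hts⟩ := ENNReal.lt_iff_exists_nnreal_btwn.1 hs
    refine le_trans ?_ hts.le
    rw [← ENNReal.ofReal_coe_nnreal] at ht ⊢
    have ht' : Real.logb k r < t := (ENNReal.ofReal_lt_ofReal_iff_of_nonneg hlog).1 ht
    refine dimH_le_of_card_cubes_le hk hX.subset_unitCube t.2 (C := n) (hupper ?_)
    rw [hofr]
    exact (ENNReal.ofReal_lt_ofReal_iff (by positivity)).2
      ((Real.logb_lt_iff_lt_rpow hk1 hr0).1 ht')
  -- A `t` strictly between `dimH X` and `log_k ρ(A)` would give counts of order `k ^ (t m)`, hence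
  -- `ρ(A) ≤ k ^ t`.
  · by_contra! h
    obtain ⟨t, hdim, ht⟩ := ENNReal.lt_iff_exists_nnreal_btwn.1 h
    rw [← ENNReal.ofReal_coe_nnreal] at ht hdim
    have ht' : t < Real.logb k r := (ENNReal.ofReal_lt_ofReal_iff_of_nonneg t.2).1 ht
    have ht0 : 0 < (t : ℝ) := ENNReal.ofReal_pos.1 (zero_le.trans_lt hdim)
    obtain ⟨C, hC⟩ := exists_card_cubes_le hk hX ht0 hdim
    have hle := natSpectralRadius_le_of_sum_le (copyMatrix k Y) (C := C) (q := (k : ℝ) ^ (t : ℝ))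
      (by positivity) fun m i => by
        rw [hcount]
        exact hC m _ (hmem i)
    rw [hofr] at hle
    have hle' := (ENNReal.ofReal_le_ofReal_iff (by positivity)).1 hle
    exact absurd ((Real.logb_le_iff_le_rpow hk1 hr0).2 hle') (not_le.2 ht')
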